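/- **Setting.** Let $\Sigma$ be an alphabet with an operation $a\mapsto\bar a$ with $\bar{\bar a}=a$, partitioned into $\Sigma^+,\Sigma^-$ with $a\in\Sigma^+$ iff $\bar a\in\Sigma^-$; put $\overline{a_1\cdots a_n}=\bar a_n\cdots\bar a_1$. Let $S$ be a set of productions $a\to u$ ($a\in\Sigma$, $u\in\Sigma^*$) that is closed ($a\to u\in S$ implies $\bar a\to\bar u\in S$) and regular (for each $a$ the language $L_a(S)$ of all strings obtained from $a$ by rewriting with $S$ is regular). Let $\mathcal A=(\Sigma,Q,I,F_{\mathcal A},\delta)$ be a finite automaton without silent transitions representing $\bigcup_a L_a(S)$, with for each $a$ a designated initial state $init_a\in I$ such that $\mathcal A$ started in $init_a$ accepts exactly $L_a(S)$. Write $s\xrightarrow{a}t$ for its transitions. Formulae are in negation normal form: $A::=p\mid\neg p\mid A\lor A\mid A\land A\mid [a]A\mid\langle a\rangle A$; a labelled formula is $s:A$ with $s\in Q$. A nested sequent $\Gamma$ is a finite tree whose nodes carry finite multisets $\Gamma|i$ of formulae and labelled formulae and whose edges are labelled with letters; $i\rhd_a j$ means that $j$ is a child of $i$ along an edge labelled $a$;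 $\Gamma(i\ll\Delta)$ is $\Gamma$ with the sequent $\Delta$ added to node $i$; $[a]\{A\}$ as a sequent is an empty root with one child, along an edge labelled $a$, carrying $A$. $\{F\}$ is the one-node sequent carrying $F$. **The calculus $\mathrm{DKm}(\mathcal A)$** derives $\Gamma$ if some node contains $p$ and $\neg p$, and otherwise by the rules (conclusion $\Gamma$; premises listed): if $A\land B\in\Gamma|i$: $\Gamma(i\ll A)$ and $\Gamma(i\ll B)$; if $A\lor B\in\Gamma|i$: $\Gamma(i\ll A,B)$; if $[a]A\in\Gamma|i$: $\Gamma(i\ll[a]\{A\})$; if $i\rhd_a j$ and $\langle a\rangle A\in\Gamma|i$: $\Gamma(j\ll A)$; if $i\rhd_a j$ and $\langle\bar a\rangle A\in\Gamma|j$: $\Gamma(i\ll A)$; if $\langle a\rangle A\in\Gamma|i$: $\Gamma(i\ll init_a:A)$; if $s:A\in\Gamma|i$, $s\in F_{\mathcal A}$: $\Gamma(i\ll A)$; if $i\rhd_a j$, $s\xrightarrow{a}t$, $s:A\in\Gamma|i$: $\Gamma(j\ll t:A)$; if $i\rhd_a j$, $s\xrightarrow{\bar a}t$, $s:A\in\Gamma|j$: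 $\Gamma(i\ll t:A)$. A formula $F$ is provable if $\{F\}$ is derivable. **Stability.** A node $i$ is saturated if it contains no formula together with its negation (in negation normal form), contains $A$ and $B$ whenever it contains $A\lor B$, and contains $A$ or $B$ whenever it contains $A\land B$. It is realised if for each $[a]A\in\Gamma|i$ there is $j$ with $i\rhd_a j$ and $A\in\Gamma|j$. A leaf $i$ is a loop node if $\Gamma|i=\Gamma|j$ for some proper ancestor $j$. $\Gamma$ is $\mathcal A$-propagated if for all nodes $i$: $\langle a\rangle A\in\Gamma|i$ implies $init_a:A\in\Gamma|i$; $s:A\in\Gamma|i$ and $s\in F_{\mathcal A}$ imply $A\in\Gamma|i$; $s:A\in\Gamma|i$, $i\rhd_a j$, $s\xrightarrow{a}t$ imply $t:A\in\Gamma|j$; and $s:A\in\Gamma|i$, $j\rhd_a i$, $s\xrightarrow{\bar a}t$ imply $t:A\in\Gamma|j$. $\Gamma$ is $\mathcal A$-stable if all nodes are saturated, $\Gamma$ is $\mathcal A$-propagated, all internal nodes are realised, and every leaf is a loop node or realised. **The procedure $Prove_1(\mathcal A,\Gamma)$** uses the first applicable of the following cases (choices of nodes and formulae within a case are arbitrary).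 1. Some node contains $p$ and $\neg p$: return $\top$. 2. $\Gamma$ is $\mathcal A$-stable: return $\bot$. 3. Either $A\lor B\in\Gamma|i$ and $A$ or $B$ is not in $\Gamma|i$: call $Prove_1$ on $\Gamma(i\ll A,B)$; or $A\land B\in\Gamma|i$ and neither $A$ nor $B$ is in $\Gamma|i$: call it on $\Gamma(i\ll A)$ and on $\Gamma(i\ll B)$. 4. One of the conditions for being $\mathcal A$-propagated fails: add the missing formula or labelled formula to the node where it is missing, and call. 5. Some internal node $i$ has $[a]A\in\Gamma|i$ with $A\notin\Gamma|j$ for all $j$ with $i\rhd_a j$: call on $\Gamma(i\ll[a]\{A\})$. 6. Some leaf $i$ is neither realised nor a loop node, and $[a]A\in\Gamma|i$: call on $\Gamma(i\ll[a]\{A\})$. After recursive calls it returns $\bot$ if some call returns $\bot$, and $\top$ if all of them return $\top$. **Theorem.** Let $F$ be a formula. 1. If (some run of) $Prove_1(\mathcal A,\{F\})$ returns $\top$, then $F$ is provable in $\mathrm{DKm}(\mathcal A)$. 2. If (some run of) $Prove_1(\mathcal A,\{F\})$ returns $\bot$, then $F$ is not provable in $\mathrm{DKm}(\mathcal A)$.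 Moreover, there is then an $\mathcal A$-stable sequent $\Delta$, reached from $\{F\}$ by the recursive calls of the procedure, that gives a countermodel $\langle W,R,V\rangle$ as follows. $W$ is the set of realised nodes of $\Delta$. Let $\mathcal P$ be the transition system on the nodes of $\Delta$ with transitions $x\xrightarrow{a}y$ and $y\xrightarrow{\bar a}x$ for each edge $x\rhd_a y$, in which each unrealised node $k'$ is then identified with its closest proper ancestor $k$ with $\Delta|k=\Delta|k'$. Put $R_a(x,y)$ iff $\mathcal P$ has a path from $x$ to $y$ labelled by a string of $L_a(S)$, and $x\in V(p)$ iff $\neg p\in\Delta|x$. Then $R_{\bar a}$ is the converse of $R_a$ for every $a$; $R_{a_1}\circ\cdots\circ R_{a_n}\subseteq R_a$ for every production $a\to a_1\cdots a_n$ in $S$ (the empty composition being the identity); and the root of $\Delta$ is a world at which $F$ is false. -/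

import Mathlib

namespace GrammarLogic

universe u v w

/-! ### Alphabets with converse, semi-Thue systems -/

/-- An alphabet with a converse operation, partitioned into `pos` and its complement
in such a way that `a` is in `pos` iff the converse of `a` is in the complement. -/
class ConverseAlphabet (Sg : Type u) where
  conv : Sg → Sg
  conv_conv : ∀ a, conv (conv a) = a
  pos : Set Sg
  mem_pos_iff : ∀ a, a ∈ pos ↔ conv a ∈ posᶜ

/-- The converse of a letter. -/
def conv {Sg : Type u} [ConverseAlphabet Sg] (a : Sg) : Sg := ConverseAlphabet.conv a

/-- The converse of a string: reverse it and take the converse of each letter. -/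
def convStr {Sg : Type u} [ConverseAlphabet Sg] (s : List Sg) : List Sg :=
  (s.map conv).reverse

/-- A semi-Thue system: a set of production rules `s → t`, given as pairs `(s, t)`. -/
abbrev SemiThue (Sg : Type u) := Set (List Sg × List Sg)

namespace SemiThue

/-- If `s → t` is a rule, so is the rule between the converses. -/
def IsClosed {Sg : Type u} [ConverseAlphabet Sg] (S : SemiThue Sg) : Prop :=
  ∀ s t, (s, t) ∈ S → (convStr s, convStr t) ∈ S

/-- Every rule rewrites a single letter. -/
def IsContextFree {Sg : Type u} (S : SemiThue Sg) : Prop :=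
  ∀ s t, (s, t) ∈ S → ∃ a, s = [a]

/-- One rewriting step at an arbitrary place of a string. -/
def RewritesTo {Sg : Type u} (S : SemiThue Sg) (x y : List Sg) : Prop :=
  ∃ l r s t, (s, t) ∈ S ∧ x = l ++ s ++ r ∧ y = l ++ t ++ r

/-- The language of all strings reachable from the letter `a` by rewriting. -/
def lang {Sg : Type u} (S : SemiThue Sg) (a : Sg) : Language Sg :=
  {s | Relation.ReflTransGen S.RewritesTo [a] s}

/-- A regular system: context-free, and the language of each letter is regular. -/
def IsRegular {Sg : Type u} (S : SemiThue Sg) : Prop :=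
  S.IsContextFree ∧ ∀ a, (S.lang a).IsRegular

end SemiThue

/-- The automaton `M` with `q` as its only initial state. -/
def startAt {Sg : Type u} {Q : Type v} (M : NFA Sg Q) (q : Q) : NFA Sg Q :=
  { M with start := {q} }

/-- `M` (an automaton without silent transitions) represents the union of the languages of
the letters; each letter `a` has its own designated initial state `ini a`, and `M` started in
that state accepts the language of `a`. -/
structure Represents {Sg : Type u} {Q : Type v} (M : NFA Sg Q) (ini : Sg → Q)
    (S : SemiThue Sg) : Prop where
  ini_mem : ∀ a, ini a ∈ M.start
  accepts_startAt : ∀ a, (startAt M (ini a)).accepts = S.lang a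
  mem_accepts_iff : ∀ s, s ∈ M.accepts ↔ ∃ a, s ∈ S.lang a

/-! ### Formulae in negation normal form and their semantics -/

/-- Multi-modal formulae in negation normal form; atoms are indexed by natural numbers. -/
inductive Form (Sg : Type u) : Type u
  | atom : ℕ → Form Sg
  | natom : ℕ → Form Sg
  | disj : Form Sg → Form Sg → Form Sg
  | conj : Form Sg → Form Sg → Form Sg
  | box : Sg → Form Sg → Form Sg
  | dia : Sg → Form Sg → Form Sg

/-- The negation normal form of the negation. -/
def Form.neg {Sg : Type u} : Form Sg → Form Sg
  | .atom p => .natom p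
  | .natom p => .atom p
  | .disj A B => .conj A.neg B.neg
  | .conj A B => .disj A.neg B.neg
  | .box a A => .dia a A.neg
  | .dia a A => .box a A.neg

/-- A family of binary relations together with a valuation. -/
structure Model (Sg : Type u) (W : Type w) where
  R : Sg → W → W → Prop
  V : ℕ → Set W

namespace Model

/-- The frame of the model is a frame for the alphabet: there is a world, and the relations for
converse letters are converses of each other. -/
def IsFrame {Sg : Type u} [ConverseAlphabet Sg] {W : Type w} (K : Model Sg W) : Prop :=
  Nonempty W ∧ ∀ a x y, K.R a x y ↔ K.R (conv a) y x

/-- The accessibility relation of a string: composition of the relations of its letters. -/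
def RStr {Sg : Type u} {W : Type w} (K : Model Sg W) : List Sg → W → W → Prop
  | [], x, y => x = y
  | a :: s, x, y => ∃ z, K.R a x z ∧ K.RStr s z y

/-- The frame of the model satisfies every production rule of `S`. -/
def SatisfiesSystem {Sg : Type u} {W : Type w} (K : Model Sg W) (S : SemiThue Sg) : Prop :=
  ∀ s t, (s, t) ∈ S → ∀ x y, K.RStr t x y → K.RStr s x y

/-- Truth of a formula at a world. -/
def Sat {Sg : Type u} {W : Type w} (K : Model Sg W) : W → Form Sg → Prop
  | x, .atom p => x ∈ K.V p
  | x, .natom p => x ∉ K.V p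
  | x, .disj A B => K.Sat x A ∨ K.Sat x B
  | x, .conj A B => K.Sat x A ∧ K.Sat x B
  | x, .box a A => ∀ y, K.R a x y → K.Sat y A
  | x, .dia a A => ∃ y, K.R a x y ∧ K.Sat y A

end Model

/-! ### Nested sequents as trees -/

/-- A formula, or a formula labelled with a state of the automaton. -/
inductive LForm (Sg : Type u) (Q : Type v) : Type (max u v)
  | plain : Form Sg → LForm Sg Q
  | lab : Q → Form Sg → LForm Sg Q

/-- A nested sequent: a multiset of (labelled) formulae together with finitely many nested
sequents, each under a structural connective indexed by a letter. The list of children only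
serves to give each node an identifier (its position): nothing below depends on its order. -/
inductive NSeq (Sg : Type u) (Q : Type v) : Type (max u v)
  | node : Multiset (LForm Sg Q) → List (Sg × NSeq Sg Q) → NSeq Sg Q

/-- Node identifiers: the path of child indices from the root. The root is `[]`. -/
abbrev Pos := List ℕ

namespace NSeq

variable {Sg : Type u} {Q : Type v}

/-- The formulae in the root node. -/
def forms : NSeq Sg Q → Multiset (LForm Sg Q)
  | node fs _ => fs

/-- The immediate subsequents, with the letters of their edges. -/
def children : NSeq Sg Q → List (Sg × NSeq Sg Q)
  | node _ cs => cs

/-- The subtree at a position, if that position is a node. -/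
def subAt : NSeq Sg Q → Pos → Option (NSeq Sg Q)
  | G, [] => some G
  | G, k :: i => (G.children[k]?).bind fun c => c.2.subAt i

/-- `i` is (the position of) a node of the tree. -/
def IsNode (G : NSeq Sg Q) (i : Pos) : Prop := (G.subAt i).isSome

/-- The multiset of formulae at node `i` (empty if `i` is not a node). -/
def at' (G : NSeq Sg Q) (i : Pos) : Multiset (LForm Sg Q) :=
  (G.subAt i).elim 0 forms

/-- `j` is a child of `i`, along an edge labelled `a`. -/
def Edge (G : NSeq Sg Q) (i : Pos) (a : Sg) (j : Pos) : Prop :=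
  ∃ D k E, G.subAt i = some D ∧ D.children[k]? = some (a, E) ∧ j = i ++ [k]

/-- A node without children. -/
def IsLeaf (G : NSeq Sg Q) (i : Pos) : Prop :=
  G.IsNode i ∧ ∀ a j, ¬ G.Edge i a j

/-- A node that is not a leaf. -/
def IsInternal (G : NSeq Sg Q) (i : Pos) : Prop :=
  G.IsNode i ∧ ¬ G.IsLeaf i

/-- `j` is a (proper) ancestor of `i`. -/
def Ancestor (j i : Pos) : Prop := j <+: i ∧ j ≠ i

/-- `G.add i D` is obtained from `G` by adding the sequent `D` to node `i`. Equivalently, it is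
the result of filling with `D` the hole of a context whose hole is in node `i`. -/
def add : NSeq Sg Q → Pos → NSeq Sg Q → NSeq Sg Q
  | node fs cs, [], D => node (fs + D.forms) (cs ++ D.children)
  | node fs cs, k :: i, D => node fs (cs.modify k fun c => (c.1, c.2.add i D))

/-- The sequent consisting of a multiset of (labelled) formulae. -/
def ofForms (fs : Multiset (LForm Sg Q)) : NSeq Sg Q := node fs []

/-- The sequent consisting of the single formula `A`. -/
def single (A : Form Sg) : NSeq Sg Q := ofForms {.plain A}

/-- The sequent consisting of the formula `A` under the structural connective for `a`. -/
def boxed (a : Sg) (A : Form Sg) : NSeq Sg Q := node 0 [(a, single A)]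

/-- Some node contains an atom and its negation. -/
def HasId (G : NSeq Sg Q) : Prop :=
  ∃ i p, .plain (.atom p) ∈ G.at' i ∧ .plain (.natom p) ∈ G.at' i

end NSeq

open NSeq LForm Form

/-! ### The calculus `DKm` for an automaton -/

/-- Provability in the deep inference calculus `DKm` extended with the propagation rules `ruleI`,
`ruleF`, `tUp`, `tDown` of the automaton. A sequent is of the form `G'[A]`, with the hole in
node `i`, exactly if `A` is in node `i`. -/
inductive Derivable {Sg : Type u} {Q : Type v} [ConverseAlphabet Sg]
    (M : NFA Sg Q) (ini : Sg → Q) : NSeq Sg Q → Prop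
  | ident {G : NSeq Sg Q} {i : Pos} {p : ℕ} :
      plain (atom p) ∈ G.at' i → plain (natom p) ∈ G.at' i → Derivable M ini G
  | conj {G : NSeq Sg Q} {i : Pos} {A B : Form Sg} :
      plain (Form.conj A B) ∈ G.at' i →
      Derivable M ini (G.add i (single A)) → Derivable M ini (G.add i (single B)) →
      Derivable M ini G
  | disj {G : NSeq Sg Q} {i : Pos} {A B : Form Sg} :
      plain (Form.disj A B) ∈ G.at' i →
      Derivable M ini (G.add i (ofForms {plain A, plain B})) → Derivable M ini G
  | box {G : NSeq Sg Q} {i : Pos} {a : Sg} {A : Form Sg} :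
      plain (Form.box a A) ∈ G.at' i →
      Derivable M ini (G.add i (boxed a A)) → Derivable M ini G
  | diaUp {G : NSeq Sg Q} {i j : Pos} {a : Sg} {A : Form Sg} :
      G.Edge i a j → plain (dia a A) ∈ G.at' i →
      Derivable M ini (G.add j (single A)) → Derivable M ini G
  | diaDown {G : NSeq Sg Q} {i j : Pos} {a : Sg} {A : Form Sg} :
      G.Edge i a j → plain (dia (conv a) A) ∈ G.at' j →
      Derivable M ini (G.add i (single A)) → Derivable M ini G
  | ruleI {G : NSeq Sg Q} {i : Pos} {a : Sg} {A : Form Sg} :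
      plain (dia a A) ∈ G.at' i →
      Derivable M ini (G.add i (ofForms {lab (ini a) A})) → Derivable M ini G
  | ruleF {G : NSeq Sg Q} {i : Pos} {s : Q} {A : Form Sg} :
      s ∈ M.accept → lab s A ∈ G.at' i →
      Derivable M ini (G.add i (single A)) → Derivable M ini G
  | tUp {G : NSeq Sg Q} {i j : Pos} {a : Sg} {s t : Q} {A : Form Sg} :
      G.Edge i a j → t ∈ M.step s a → lab s A ∈ G.at' i →
      Derivable M ini (G.add j (ofForms {lab t A})) → Derivable M ini G
  | tDown {G : NSeq Sg Q} {i j : Pos} {a : Sg} {s t : Q} {A : Form Sg} :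
      G.Edge i a j → t ∈ M.step s (conv a) → lab s A ∈ G.at' j →
      Derivable M ini (G.add i (ofForms {lab t A})) → Derivable M ini G

/-! ### Saturation, realisation, propagation, stability -/

namespace NSeq

/-- A saturated node. -/
def Saturated {Sg : Type u} {Q : Type v} (G : NSeq Sg Q) (i : Pos) : Prop :=
  (∀ A : Form Sg, plain A ∈ G.at' i → plain A.neg ∉ G.at' i) ∧
  (∀ A B : Form Sg, plain (disj A B) ∈ G.at' i → plain A ∈ G.at' i ∧ plain B ∈ G.at' i) ∧
  (∀ A B : Form Sg, plain (conj A B) ∈ G.at' i → plain A ∈ G.at' i ∨ plain B ∈ G.at' i)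

/-- A realised node. -/
def Realised {Sg : Type u} {Q : Type v} (G : NSeq Sg Q) (i : Pos) : Prop :=
  ∀ (a : Sg) (A : Form Sg), plain (box a A) ∈ G.at' i → ∃ j, G.Edge i a j ∧ plain A ∈ G.at' j

/-- The sequent is propagated with respect to the automaton. -/
def Propagated {Sg : Type u} {Q : Type v} [ConverseAlphabet Sg]
    (M : NFA Sg Q) (ini : Sg → Q) (G : NSeq Sg Q) : Prop :=
  ∀ i, G.IsNode i →
    (∀ a A, plain (dia a A) ∈ G.at' i → lab (ini a) A ∈ G.at' i) ∧
    (∀ s A, lab s A ∈ G.at' i → s ∈ M.accept → plain A ∈ G.at' i) ∧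
    (∀ j a s t, G.Edge i a j → t ∈ M.step s a →
      ∀ A, lab s A ∈ G.at' i → lab t A ∈ G.at' j) ∧
    (∀ j a s t, G.Edge j a i → t ∈ M.step s (conv a) →
      ∀ A, lab s A ∈ G.at' i → lab t A ∈ G.at' j)

/-- A loop node: a leaf with the same formulae as some ancestor. -/
def IsLoop {Sg : Type u} {Q : Type v} (G : NSeq Sg Q) (i : Pos) : Prop :=
  G.IsLeaf i ∧ ∃ j, Ancestor j i ∧ G.at' i = G.at' j

/-- The sequent is stable with respect to the automaton. -/
def Stable {Sg : Type u} {Q : Type v} [ConverseAlphabet Sg]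
    (M : NFA Sg Q) (ini : Sg → Q) (G : NSeq Sg Q) : Prop :=
  (∀ i, G.IsNode i → G.Saturated i) ∧
  G.Propagated M ini ∧
  (∀ i, G.IsInternal i → G.Realised i) ∧
  (∀ i, G.IsLeaf i → G.IsLoop i ∨ G.Realised i)

end NSeq

/-! ### The procedure -/

/-- `ProofStep M ini n G Gs`: the conditions in the `n`-th case of the procedure are met by `G`
for some choice of node and formula, and with this choice the recursive calls are those on the
members of `Gs`. (The first two cases make no recursive call.) -/
inductive ProofStep {Sg : Type u} {Q : Type v} [ConverseAlphabet Sg]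
    (M : NFA Sg Q) (ini : Sg → Q) : ℕ → NSeq Sg Q → List (NSeq Sg Q) → Prop
  | disj {G : NSeq Sg Q} {i : Pos} {A B : Form Sg} :
      plain (Form.disj A B) ∈ G.at' i → plain A ∉ G.at' i ∨ plain B ∉ G.at' i →
      ProofStep M ini 3 G [G.add i (ofForms {plain A, plain B})]
  | conj {G : NSeq Sg Q} {i : Pos} {A B : Form Sg} :
      plain (Form.conj A B) ∈ G.at' i → plain A ∉ G.at' i → plain B ∉ G.at' i →
      ProofStep M ini 3 G [G.add i (single A), G.add i (single B)]
  | propI {G : NSeq Sg Q} {i : Pos} {a : Sg} {A : Form Sg} :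
      plain (dia a A) ∈ G.at' i → lab (ini a) A ∉ G.at' i →
      ProofStep M ini 4 G [G.add i (ofForms {lab (ini a) A})]
  | propF {G : NSeq Sg Q} {i : Pos} {s : Q} {A : Form Sg} :
      lab s A ∈ G.at' i → s ∈ M.accept → plain A ∉ G.at' i →
      ProofStep M ini 4 G [G.add i (single A)]
  | propUp {G : NSeq Sg Q} {i j : Pos} {a : Sg} {s t : Q} {A : Form Sg} :
      lab s A ∈ G.at' i → G.Edge i a j → t ∈ M.step s a → lab t A ∉ G.at' j →
      ProofStep M ini 4 G [G.add j (ofForms {lab t A})]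
  | propDown {G : NSeq Sg Q} {i j : Pos} {a : Sg} {s t : Q} {A : Form Sg} :
      lab s A ∈ G.at' i → G.Edge j a i → t ∈ M.step s (conv a) → lab t A ∉ G.at' j →
      ProofStep M ini 4 G [G.add j (ofForms {lab t A})]
  | realise {G : NSeq Sg Q} {i : Pos} {a : Sg} {A : Form Sg} :
      G.IsInternal i → plain (Form.box a A) ∈ G.at' i →
      (∀ j, G.Edge i a j → plain A ∉ G.at' j) →
      ProofStep M ini 5 G [G.add i (boxed a A)]
  | expand {G : NSeq Sg Q} {i : Pos} {a : Sg} {A : Form Sg} :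
      G.IsLeaf i → ¬ G.Realised i → ¬ G.IsLoop i → plain (Form.box a A) ∈ G.at' i →
      ProofStep M ini 6 G [G.add i (boxed a A)]

/-- The procedure called on `G` does not return immediately by one of its first two cases, and it
may proceed by the recursive calls on the members of `Gs`: the cases are tried in order, a case
being used only if none of the earlier ones applies. -/
def Proceeds {Sg : Type u} {Q : Type v} [ConverseAlphabet Sg]
    (M : NFA Sg Q) (ini : Sg → Q) (G : NSeq Sg Q) (Gs : List (NSeq Sg Q)) : Prop :=
  ¬ G.HasId ∧ ¬ G.Stable M ini ∧
    ∃ n, ProofStep M ini n G Gs ∧ ∀ m < n, ∀ Ds, ¬ ProofStep M ini m G Ds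

/-- A call on `G` may make a recursive call on `D`. -/
def Calls {Sg : Type u} {Q : Type v} [ConverseAlphabet Sg]
    (M : NFA Sg Q) (ini : Sg → Q) (G D : NSeq Sg Q) : Prop :=
  ∃ Gs, Proceeds M ini G Gs ∧ D ∈ Gs

/-- `ProveReturns M ini G r`: some run of the procedure on `G` (that is, some way to make the
choices of node and formula that the procedure leaves open) returns `r`, where `true` stands for
the answer "top" and `false` for the answer "bottom". -/
inductive ProveReturns {Sg : Type u} {Q : Type v} [ConverseAlphabet Sg]
    (M : NFA Sg Q) (ini : Sg → Q) : NSeq Sg Q → Bool → Prop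
  | ident {G : NSeq Sg Q} : G.HasId → ProveReturns M ini G true
  | stable {G : NSeq Sg Q} : ¬ G.HasId → G.Stable M ini → ProveReturns M ini G false
  | callsTop {G : NSeq Sg Q} {Gs : List (NSeq Sg Q)} : Proceeds M ini G Gs →
      (∀ D ∈ Gs, ProveReturns M ini D true) → ProveReturns M ini G true
  | callsBot {G : NSeq Sg Q} {Gs : List (NSeq Sg Q)} {D : NSeq Sg Q} : Proceeds M ini G Gs →
      D ∈ Gs → ProveReturns M ini D false → ProveReturns M ini G false

/-! ### The model obtained by identifying loop nodes with ancestors -/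

namespace NSeq

variable {Sg : Type u} {Q : Type v}

/-- `k` is the closest ancestor of `i` with the same formulae as `i`. -/
def ClosestTwin (G : NSeq Sg Q) (i k : Pos) : Prop :=
  (Ancestor k i ∧ G.at' i = G.at' k) ∧
    ∀ j, Ancestor j i → G.at' i = G.at' j → j <+: k

/-- The identification: a realised node stands for itself, an unrealised node is identified with
its closest ancestor with the same formulae. -/
def Identified (G : NSeq Sg Q) (i k : Pos) : Prop :=
  G.IsNode i ∧ ((G.Realised i ∧ k = i) ∨ (¬ G.Realised i ∧ G.ClosestTwin i k))

/-- The propagation automaton of `G` from node `x` to node `y`: each edge can be travelled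
forwards, and backwards under the converse letter. -/
def propAut [ConverseAlphabet Sg] (G : NSeq Sg Q) (x y : Pos) : NFA Sg Pos where
  step i a := {j | G.Edge i a j ∨ G.Edge j (conv a) i}
  start := {x}
  accept := {y}

/-- The propagation automaton after the identification of unrealised nodes with ancestors. -/
def loopAut [ConverseAlphabet Sg] (G : NSeq Sg Q) (x y : Pos) : NFA Sg Pos where
  step i a := {j | ∃ i₀ j₀, G.Identified i₀ i ∧ G.Identified j₀ j ∧
    j₀ ∈ (G.propAut x y).step i₀ a}
  start := {x}
  accept := {y}

/-- The worlds are the realised nodes; `y` is `a`-accessible from `x` if the identified propagation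
automaton from `x` to `y` and `M` started in the initial state of `a` accept a common string;
an atom holds at a node exactly if its negation occurs there. -/
def loopModel [ConverseAlphabet Sg] (M : NFA Sg Q) (ini : Sg → Q) (G : NSeq Sg Q) :
    Model Sg {i : Pos // G.IsNode i ∧ G.Realised i} where
  R a x y := ∃ s, s ∈ (G.loopAut x.1 y.1).accepts ∧ s ∈ (startAt M (ini a)).accepts
  V p := {x | plain (natom p) ∈ G.at' x.1}

end NSeq

end GrammarLogic

namespace GrammarLogic

universe u v w

/-! ### Runs of a transition relation -/

/-! Every recursive call of the procedure is on a premise of a rule of the calculus, read from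
conclusion to premises, so a run returning top unfolds into a derivation (`ProofStep.derivable`).

The answer bottom can only originate at a stable sequent `D` reached by calls. Calls never delete
formulae, so the root of `D` still carries `F`. In `loopModel`, accessibility by `a` means a path
spelling a string of the language of `a`. These languages are compatible with converse because the
system is closed, and with productions because rewriting the letters of a string separately rewrites
the string; hence the model satisfies the frame conditions (`Stable.isFrame_loopModel`,
`satisfiesSystem_loopModel`). Every formula at a realised node is false there
(`Stable.not_sat_loopModel`). The main case is a diamond: its labelled copy moves along a path in
step with a run of the automaton (`Propagated.lab_mem_of_run`), and identifying nodes is harmless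
because identified nodes carry equal multisets.

Non-derivability follows from soundness, applied to this same model. If the nodes of a conclusion
are interpreted by worlds falsifying all their formulae, then so are the nodes of some premise,
possibly under another interpretation, while an axiom has no such interpretation
(`Derivable.not_refutes`). -/

/-- `Run r x s y`: the labelled transition relation `r` has a path from `x` to `y` reading `s`. -/
def Run {α : Type u} {σ : Type v} (r : σ → α → σ → Prop) : σ → List α → σ → Prop
  | x, [], y => x = y
  | x, a :: s, y => ∃ z, r x a z ∧ Run r z s y

theorem Run.append {α : Type u} {σ : Type v} {r : σ → α → σ → Prop} {x y z : σ} {s t : List α}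
    (h₁ : Run r x s y) (h₂ : Run r y t z) : Run r x (s ++ t) z := by
  induction s generalizing x with
  | nil => cases h₁; exact h₂
  | cons a s ih =>
    obtain ⟨x', hx, h⟩ := h₁
    exact ⟨x', hx, ih h⟩

/-- Replaces subset simulation by a single path, so that a path in the tree and a run of the
automaton can be followed together letter by letter. -/
theorem NFA_mem_evalFrom_iff_run {α : Type u} {σ : Type v} (N : NFA α σ) (x y : σ) (s : List α) :
    y ∈ N.evalFrom {x} s ↔ Run (fun i a j => j ∈ N.step i a) x s y := by
  induction s generalizing x with
  | nil => simp [Run, eq_comm]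
  | cons a s ih =>
    rw [NFA.evalFrom_cons, NFA.stepSet_singleton, NFA.mem_evalFrom_iff_exists]
    simp only [Run, ih]

theorem mem_accepts_startAt {Sg : Type u} {Q : Type v} (M : NFA Sg Q) (q : Q) (s : List Sg) :
    s ∈ (startAt M q).accepts ↔
      ∃ t ∈ M.accept, Run (fun i a j => j ∈ M.step i a) q s t := by
  rw [NFA.mem_accepts]
  change (∃ t ∈ M.accept, t ∈ (startAt M q).evalFrom {q} s) ↔ _
  simp only [NFA_mem_evalFrom_iff_run]
  rfl

/-! ### Converse strings and the languages of letters -/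

section Strings

variable {Sg : Type u} [ConverseAlphabet Sg]

@[simp] theorem conv_conv (a : Sg) : conv (conv a) = a := ConverseAlphabet.conv_conv a

theorem convStr_append (s t : List Sg) : convStr (s ++ t) = convStr t ++ convStr s := by
  simp [convStr]

@[simp] theorem convStr_singleton (a : Sg) : convStr [a] = [conv a] := rfl

theorem convStr_cons (a : Sg) (s : List Sg) : convStr (a :: s) = convStr s ++ [conv a] := by
  simp [convStr]

@[simp] theorem convStr_convStr (s : List Sg) : convStr (convStr s) = s := by
  induction s with
  | nil => rfl
  | cons a s ih => rw [convStr_cons, convStr_append, ih]; simp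

theorem Run.converse {σ : Type v} {r : σ → Sg → σ → Prop}
    (hr : ∀ x a y, r x a y → r y (conv a) x) {x y : σ} {s : List Sg} (h : Run r x s y) :
    Run r y (convStr s) x := by
  induction s generalizing x with
  | nil => exact Eq.symm h
  | cons a s ih =>
    obtain ⟨z, hz, h⟩ := h
    rw [convStr_cons]
    exact (ih h).append ⟨x, hr _ _ _ hz, rfl⟩

end Strings

namespace SemiThue

variable {Sg : Type u}

theorem RewritesTo.context {S : SemiThue Sg} (l r : List Sg) {x y : List Sg}
    (h : S.RewritesTo x y) : S.RewritesTo (l ++ x ++ r) (l ++ y ++ r) := by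
  obtain ⟨l', r', s, t, hst, rfl, rfl⟩ := h
  exact ⟨l ++ l', r' ++ r, s, t, hst, by simp, by simp⟩

theorem reflTransGen_context {S : SemiThue Sg} (l r : List Sg) {x y : List Sg}
    (h : Relation.ReflTransGen S.RewritesTo x y) :
    Relation.ReflTransGen S.RewritesTo (l ++ x ++ r) (l ++ y ++ r) :=
  h.lift (fun z => l ++ z ++ r) fun _ _ => RewritesTo.context l r

theorem reflTransGen_append {S : SemiThue Sg} {x y x' y' : List Sg}
    (h : Relation.ReflTransGen S.RewritesTo x y)
    (h' : Relation.ReflTransGen S.RewritesTo x' y') :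
    Relation.ReflTransGen S.RewritesTo (x ++ x') (y ++ y') := by
  have h₁ := reflTransGen_context [] x' h
  have h₂ := reflTransGen_context y [] h'
  simp only [List.nil_append, List.append_nil] at h₁ h₂
  exact h₁.trans h₂

/-- A closed system contains the converse of each rule, so taking converses maps one rewriting step
to one rewriting step, with the left and right contexts exchanged. -/
theorem convStr_mem_lang [ConverseAlphabet Sg] {S : SemiThue Sg} (hS : S.IsClosed) {a : Sg} {s : List Sg}
    (h : s ∈ S.lang a) : convStr s ∈ S.lang (conv a) := by
  refine Relation.ReflTransGen.lift (p := S.RewritesTo) convStr ?_ _ _ h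
  rintro _ _ ⟨l, r, s, t, hst, rfl, rfl⟩
  exact ⟨convStr r, convStr l, convStr s, convStr t, hS _ _ hst,
    by simp [convStr_append], by simp [convStr_append]⟩

end SemiThue

/-! ### Strings in models -/

namespace Model

variable {Sg : Type u} {W : Type w}

theorem RStr_append (K : Model Sg W) (s t : List Sg) (x y : W) :
    K.RStr (s ++ t) x y ↔ ∃ z, K.RStr s x z ∧ K.RStr t z y := by
  induction s generalizing x with
  | nil => simp [RStr]
  | cons a s ih =>
    simp only [List.cons_append, RStr, ih]
    constructor
    · rintro ⟨z, hz, z', h, h'⟩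
      exact ⟨z', ⟨z, hz, h⟩, h'⟩
    · rintro ⟨z', ⟨z, hz, h⟩, h'⟩
      exact ⟨z, hz, z', h, h'⟩

theorem RStr_singleton (K : Model Sg W) (a : Sg) (x y : W) : K.RStr [a] x y ↔ K.R a x y := by
  simp [RStr]

/-- Rewriting steps are undone from the last to the first: each production used lets the path
segment for its right side be replaced by one for its left side, until the single letter `a`
remains. -/
theorem SatisfiesSystem.R_of_mem_lang {K : Model Sg W} {S : SemiThue Sg}
    (hK : K.SatisfiesSystem S) {a : Sg} {s : List Sg} (hs : s ∈ S.lang a) {x y : W}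
    (h : K.RStr s x y) : K.R a x y := by
  rw [← RStr_singleton]
  change Relation.ReflTransGen S.RewritesTo [a] s at hs
  induction hs generalizing x y with
  | refl => exact h
  | tail _ hst ih =>
    obtain ⟨l, r, s, t, hst, rfl, rfl⟩ := hst
    simp only [RStr_append] at h
    obtain ⟨z₂, ⟨z₁, hl, ht⟩, hr⟩ := h
    refine ih ?_
    simp only [RStr_append]
    exact ⟨z₂, ⟨z₁, hl, hK _ _ hst _ _ ht⟩, hr⟩

end Model

/-! ### Positions in nested sequents -/

namespace NSeq

variable {Sg : Type u} {Q : Type v}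

@[simp] theorem at'_nil (G : NSeq Sg Q) : G.at' [] = G.forms := rfl

theorem mem_at'_cons {G : NSeq Sg Q} {k : ℕ} {i : Pos} {l : LForm Sg Q} :
    l ∈ G.at' (k :: i) ↔ ∃ c, G.children[k]? = some c ∧ l ∈ c.2.at' i := by
  simp only [at', subAt]
  cases h : G.children[k]? <;> simp

theorem edge_nil {G : NSeq Sg Q} {a : Sg} {j : Pos} :
    G.Edge [] a j ↔ ∃ k E, G.children[k]? = some (a, E) ∧ j = [k] := by
  simp [Edge, subAt]

theorem edge_cons {G : NSeq Sg Q} {k : ℕ} {i : Pos} {a : Sg} {j : Pos} :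
    G.Edge (k :: i) a j ↔
      ∃ c j', G.children[k]? = some c ∧ c.2.Edge i a j' ∧ j = k :: j' := by
  simp only [Edge, subAt, Option.bind_eq_some_iff]
  constructor
  · rintro ⟨D, n, E, ⟨c, hc, hD⟩, hE, rfl⟩
    exact ⟨c, _, hc, ⟨D, n, E, hD, hE, rfl⟩, rfl⟩
  · rintro ⟨c, _, hc, ⟨D, n, E, hD, hE, rfl⟩, rfl⟩
    exact ⟨D, n, E, ⟨c, hc, hD⟩, hE, rfl⟩

theorem subAt_append (G : NSeq Sg Q) (i j : Pos) :
    G.subAt (i ++ j) = (G.subAt i).bind fun D => D.subAt j := by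
  induction i generalizing G with
  | nil => rfl
  | cons k i ih =>
    simp only [List.cons_append, subAt]
    cases G.children[k]? <;> simp [ih]

theorem isNode_of_mem_at' {G : NSeq Sg Q} {i : Pos} {l : LForm Sg Q} (h : l ∈ G.at' i) :
    G.IsNode i := by
  unfold IsNode
  unfold at' at h
  cases hi : G.subAt i with
  | none => simp [hi] at h
  | some D => rfl

theorem Edge.isNode_left {G : NSeq Sg Q} {i j : Pos} {a : Sg} (h : G.Edge i a j) :
    G.IsNode i := by
  obtain ⟨D, k, E, hD, -, -⟩ := h
  simp [IsNode, hD]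

theorem Edge.isNode_right {G : NSeq Sg Q} {i j : Pos} {a : Sg} (h : G.Edge i a j) :
    G.IsNode j := by
  obtain ⟨D, k, E, hD, hk, rfl⟩ := h
  simp [IsNode, subAt_append, hD, subAt, hk]

theorem children_add_cons (G : NSeq Sg Q) (k : ℕ) (i : Pos) (D : NSeq Sg Q) :
    (G.add (k :: i) D).children = G.children.modify k fun c => (c.1, c.2.add i D) := by
  cases G; rfl

theorem children_add_nil (G D : NSeq Sg Q) :
    (G.add [] D).children = G.children ++ D.children := by
  cases G; rfl

theorem forms_add_cons (G : NSeq Sg Q) (k : ℕ) (i : Pos) (D : NSeq Sg Q) :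
    (G.add (k :: i) D).forms = G.forms := by
  cases G; rfl

theorem forms_add_nil (G D : NSeq Sg Q) : (G.add [] D).forms = G.forms + D.forms := by
  cases G; rfl

theorem mem_forms_add {G : NSeq Sg Q} {l : LForm Sg Q} (h : l ∈ G.forms) (i : Pos)
    (D : NSeq Sg Q) : l ∈ (G.add i D).forms := by
  cases i with
  | nil => rw [forms_add_nil]; exact Multiset.mem_add.2 (.inl h)
  | cons k i => rwa [forms_add_cons]

/-- The nodes and formulae of the sequent added to `G` at `i`, as seen from within `G.add i D`. -/
theorem mem_at'_add {G E D : NSeq Sg Q} {i j : Pos} {l : LForm Sg Q} (hi : G.subAt i = some E)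
    (h : l ∈ (G.add i D).at' j) :
    l ∈ G.at' j ∨ (j = i ∧ l ∈ D.forms) ∨
      ∃ n j', j = i ++ (E.children.length + n) :: j' ∧ l ∈ D.at' (n :: j') := by
  induction i generalizing G j with
  | nil =>
    obtain rfl : G = E := Option.some.inj hi
    cases j with
    | nil =>
      rw [at'_nil, forms_add_nil, Multiset.mem_add] at h
      exact h.imp_right fun h => .inl ⟨rfl, h⟩
    | cons k j =>
      rw [mem_at'_cons, children_add_nil] at h
      obtain ⟨c, hc, hl⟩ := h
      by_cases hk : k < G.children.length
      · rw [List.getElem?_append_left hk] at hc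
        exact .inl (mem_at'_cons.2 ⟨c, hc, hl⟩)
      · rw [List.getElem?_append_right (not_lt.1 hk)] at hc
        refine .inr (.inr ⟨k - _, j, ?_, mem_at'_cons.2 ⟨c, hc, hl⟩⟩)
        simp only [List.nil_append, List.cons.injEq, and_true]
        omega
  | cons m i ih =>
    cases j with
    | nil =>
      rw [at'_nil, forms_add_cons] at h
      exact .inl h
    | cons k j =>
      rw [mem_at'_cons, children_add_cons] at h
      obtain ⟨c, hc, hl⟩ := h
      by_cases hk : m = k
      · subst hk
        rw [List.getElem?_modify_eq] at hc
        simp only [subAt] at hi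
        obtain ⟨c', hc', hi⟩ := Option.bind_eq_some_iff.1 hi
        rw [hc'] at hc
        cases hc
        rcases ih hi hl with h | ⟨rfl, h⟩ | ⟨n, j', rfl, h⟩
        · exact .inl (mem_at'_cons.2 ⟨c', hc', h⟩)
        · exact .inr (.inl ⟨rfl, h⟩)
        · exact .inr (.inr ⟨n, j', rfl, h⟩)
      · rw [List.getElem?_modify_ne (h := hk)] at hc
        exact .inl (mem_at'_cons.2 ⟨c, hc, hl⟩)

/-- Added children are appended after the old ones, so old positions keep their names and the `n`-th
new child gets index `E.children.length + n`. An edge is thus old, leads from `i` to a new child, or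
lies inside the added sequent. -/
theorem edge_add {G E D : NSeq Sg Q} {i x y : Pos} {a : Sg} (hi : G.subAt i = some E)
    (h : (G.add i D).Edge x a y) :
    G.Edge x a y ∨
      (∃ n C, x = i ∧ y = i ++ [E.children.length + n] ∧ D.children[n]? = some (a, C)) ∨
      ∃ n x' y', x = i ++ (E.children.length + n) :: x' ∧ D.Edge (n :: x') a y' := by
  induction i generalizing G x y with
  | nil =>
    obtain rfl : G = E := Option.some.inj hi
    cases x with
    | nil =>
      rw [edge_nil, children_add_nil] at h
      obtain ⟨k, C, hC, rfl⟩ := h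
      by_cases hk : k < G.children.length
      · rw [List.getElem?_append_left hk] at hC
        exact .inl (edge_nil.2 ⟨k, C, hC, rfl⟩)
      · rw [List.getElem?_append_right (not_lt.1 hk)] at hC
        refine .inr (.inl ⟨_, C, rfl, ?_, hC⟩)
        simp only [List.nil_append, List.cons.injEq, and_true]
        omega
    | cons k x =>
      rw [edge_cons, children_add_nil] at h
      obtain ⟨c, y', hc, he, rfl⟩ := h
      by_cases hk : k < G.children.length
      · rw [List.getElem?_append_left hk] at hc
        exact .inl (edge_cons.2 ⟨c, y', hc, he, rfl⟩)
      · rw [List.getElem?_append_right (not_lt.1 hk)] at hc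
        refine .inr (.inr ⟨_, x, _, ?_, edge_cons.2 ⟨c, y', hc, he, rfl⟩⟩)
        simp only [List.nil_append, List.cons.injEq, and_true]
        omega
  | cons m i ih =>
    simp only [subAt] at hi
    obtain ⟨c', hc', hi⟩ := Option.bind_eq_some_iff.1 hi
    cases x with
    | nil =>
      rw [edge_nil, children_add_cons] at h
      obtain ⟨k, C, hC, rfl⟩ := h
      by_cases hk : m = k
      · subst hk
        rw [List.getElem?_modify_eq, hc'] at hC
        cases hC
        exact .inl (edge_nil.2 ⟨m, _, hc', rfl⟩)
      · rw [List.getElem?_modify_ne (h := hk)] at hC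
        exact .inl (edge_nil.2 ⟨k, C, hC, rfl⟩)
    | cons k x =>
      rw [edge_cons, children_add_cons] at h
      obtain ⟨c, y', hc, he, rfl⟩ := h
      by_cases hk : m = k
      · subst hk
        rw [List.getElem?_modify_eq, hc'] at hc
        cases hc
        rcases ih hi he with h | ⟨n, C, rfl, rfl, h⟩ | ⟨n, x', y'', rfl, h⟩
        · exact .inl (edge_cons.2 ⟨c', y', hc', h, rfl⟩)
        · exact .inr (.inl ⟨n, C, rfl, rfl, h⟩)
        · exact .inr (.inr ⟨n, x', y'', rfl, h⟩)
      · rw [List.getElem?_modify_ne (h := hk)] at hc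
        exact .inl (edge_cons.2 ⟨c, y', hc, he, rfl⟩)

theorem mem_at'_add_ofForms {G : NSeq Sg Q} {fs : Multiset (LForm Sg Q)} {i j : Pos}
    {l : LForm Sg Q} (hi : G.IsNode i) (h : l ∈ (G.add i (ofForms fs)).at' j) :
    l ∈ G.at' j ∨ (j = i ∧ l ∈ fs) := by
  obtain ⟨E, hE⟩ := Option.isSome_iff_exists.1 hi
  rcases mem_at'_add hE h with h | h | ⟨n, j', -, h⟩
  · exact .inl h
  · exact .inr h
  · rw [mem_at'_cons] at h
    obtain ⟨c, hc, -⟩ := h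
    simp [ofForms, children] at hc

theorem edge_add_ofForms {G : NSeq Sg Q} {fs : Multiset (LForm Sg Q)} {i x y : Pos} {a : Sg}
    (hi : G.IsNode i) (h : (G.add i (ofForms fs)).Edge x a y) : G.Edge x a y := by
  obtain ⟨E, hE⟩ := Option.isSome_iff_exists.1 hi
  rcases edge_add hE h with h | ⟨n, C, -, -, h⟩ | ⟨n, x', y', -, h⟩
  · exact h
  · simp [ofForms, children] at h
  · rw [edge_cons] at h
    obtain ⟨c, -, hc, -⟩ := h
    simp [ofForms, children] at hc

theorem mem_at'_add_boxed {G E : NSeq Sg Q} {b : Sg} {A : Form Sg} {i j : Pos}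
    {l : LForm Sg Q} (hi : G.subAt i = some E) (h : l ∈ (G.add i (boxed b A)).at' j) :
    l ∈ G.at' j ∨ (j = i ++ [E.children.length] ∧ l = .plain A) := by
  rcases mem_at'_add hi h with h | ⟨-, h⟩ | ⟨n, j', hj, h⟩
  · exact .inl h
  · simp [boxed, forms] at h
  · rw [mem_at'_cons] at h
    obtain ⟨c, hc, h⟩ := h
    rcases n with _ | n
    · simp only [boxed, children, List.getElem?_cons_zero, Option.some.injEq] at hc
      subst hc
      cases j' with
      | nil => exact .inr ⟨hj, by simpa [single, ofForms, forms] using h⟩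
      | cons k j' =>
        rw [mem_at'_cons] at h
        obtain ⟨c, hc, -⟩ := h
        simp [single, ofForms, children] at hc
    · simp [boxed, children] at hc

theorem edge_add_boxed {G E : NSeq Sg Q} {b : Sg} {A : Form Sg} {i x y : Pos} {a : Sg}
    (hi : G.subAt i = some E) (h : (G.add i (boxed b A)).Edge x a y) :
    G.Edge x a y ∨ (x = i ∧ y = i ++ [E.children.length] ∧ a = b) := by
  rcases edge_add hi h with h | ⟨n, C, hx, hy, h⟩ | ⟨n, x', y', -, h⟩
  · exact .inl h
  · rcases n with _ | n
    · simp only [boxed, children, List.getElem?_cons_zero, Option.some.injEq, Prod.mk.injEq] at h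
      exact .inr ⟨hx, hy, h.1.symm⟩
    · simp [boxed, children] at h
  · rw [edge_cons] at h
    obtain ⟨c, y'', hc, h, -⟩ := h
    rcases n with _ | n
    · simp only [boxed, children, List.getElem?_cons_zero, Option.some.injEq] at hc
      subst hc
      cases x' with
      | nil =>
        rw [edge_nil] at h
        obtain ⟨k, C, hC, -⟩ := h
        simp [single, ofForms, children] at hC
      | cons k x' =>
        rw [edge_cons] at h
        obtain ⟨c, -, hc, -⟩ := h
        simp [single, ofForms, children] at hc
    · simp [boxed, children] at hc

/-- Freshness of the position of an appended child: an interpretation can be redefined there without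
affecting existing nodes. -/
theorem not_isNode_append_length {G E : NSeq Sg Q} {i : Pos} (hi : G.subAt i = some E) :
    ¬ G.IsNode (i ++ [E.children.length]) := by
  simp [IsNode, subAt_append, hi, subAt]

end NSeq

open NSeq LForm Form

/-! ### Soundness of the calculus -/

section Soundness

variable {Sg : Type u} {Q : Type v} {W : Type w}

/-- A plain formula is false at `x`; a labelled formula `s : A` is false at `x` if `A` is false at
all worlds reachable from `x` along a string accepted by the automaton from `s`. -/
def Falsified (M : NFA Sg Q) (K : Model Sg W) (x : W) : LForm Sg Q → Prop
  | plain A => ¬ K.Sat x A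
  | lab s A => ∀ t y, t ∈ (startAt M s).accepts → K.RStr t x y → ¬ K.Sat y A

/-- `f` interprets the nodes of `G` as worlds at which all formulae of the node are falsified. -/
structure Refutes (M : NFA Sg Q) (K : Model Sg W) (f : Pos → W) (G : NSeq Sg Q) : Prop where
  falsified : ∀ i, ∀ l ∈ G.at' i, Falsified M K (f i) l
  edge : ∀ i a j, G.Edge i a j → K.R a (f i) (f j)

theorem Refutes.add_ofForms {M : NFA Sg Q} {K : Model Sg W} {f : Pos → W} {G : NSeq Sg Q}
    (h : Refutes M K f G) {i : Pos} (hi : G.IsNode i) {fs : Multiset (LForm Sg Q)}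
    (hfs : ∀ l ∈ fs, Falsified M K (f i) l) : Refutes M K f (G.add i (ofForms fs)) where
  falsified j l hl := by
    rcases mem_at'_add_ofForms hi hl with hl | ⟨rfl, hl'⟩
    · exact h.falsified j l hl
    · exact hfs l hl'
  edge x a y he := h.edge x a y (edge_add_ofForms hi he)

theorem Refutes.add_singleton {M : NFA Sg Q} {K : Model Sg W} {f : Pos → W} {G : NSeq Sg Q}
    (h : Refutes M K f G) {i : Pos} (hi : G.IsNode i) {l : LForm Sg Q}
    (hl : Falsified M K (f i) l) : Refutes M K f (G.add i (ofForms {l})) :=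
  h.add_ofForms hi fun l' hl' => by rwa [Multiset.mem_singleton.1 hl']

theorem Refutes.exists_add_boxed {M : NFA Sg Q} {K : Model Sg W} {f : Pos → W} {G : NSeq Sg Q}
    (h : Refutes M K f G) {i : Pos} (hi : G.IsNode i) {a : Sg} {A : Form Sg} {y : W}
    (hy : K.R a (f i) y) (hA : ¬ K.Sat y A) : ∃ g, Refutes M K g (G.add i (boxed a A)) := by
  obtain ⟨E, hE⟩ := Option.isSome_iff_exists.1 hi
  have hne : ∀ j, G.IsNode j → j ≠ i ++ [E.children.length] := by
    rintro _ hj rfl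
    exact not_isNode_append_length hE hj
  refine ⟨Function.update f (i ++ [E.children.length]) y, ?_, ?_⟩
  · intro j l hl
    rcases mem_at'_add_boxed hE hl with hl | ⟨rfl, rfl⟩
    · rw [Function.update_of_ne (hne j (isNode_of_mem_at' hl))]
      exact h.falsified j l hl
    · rw [Function.update_self]
      exact hA
  · intro x b z he
    rcases edge_add_boxed hE he with he | ⟨rfl, rfl, rfl⟩
    · rw [Function.update_of_ne (hne _ he.isNode_left),
        Function.update_of_ne (hne _ he.isNode_right)]
      exact h.edge x b z he
    · rw [Function.update_of_ne (hne _ hi), Function.update_self]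
      exact hy

theorem cons_mem_accepts_startAt {M : NFA Sg Q} {s t : Q} {a : Sg} {w : List Sg}
    (ht : t ∈ M.step s a) (hw : w ∈ (startAt M t).accepts) :
    a :: w ∈ (startAt M s).accepts := by
  rw [mem_accepts_startAt] at hw ⊢
  obtain ⟨q, hq, h⟩ := hw
  exact ⟨q, hq, t, ht, h⟩

theorem nil_mem_accepts_startAt {M : NFA Sg Q} {s : Q} (hs : s ∈ M.accept) :
    [] ∈ (startAt M s).accepts :=
  (mem_accepts_startAt M s []).2 ⟨s, hs, rfl⟩

/-- Each rule passes a refutation from its conclusion to one of its premises. The interpretation `f`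
varies in the induction because the box rule needs a world for its new node. -/
theorem Derivable.not_refutes [ConverseAlphabet Sg] {S : SemiThue Sg} {M : NFA Sg Q}
    {ini : Sg → Q} (hM : Represents M ini S) {K : Model Sg W} (hF : K.IsFrame)
    (hK : K.SatisfiesSystem S) {G : NSeq Sg Q} (hG : Derivable M ini G) (f : Pos → W) :
    ¬ Refutes M K f G := by
  induction hG generalizing f with
  | ident h₁ h₂ => exact fun h => h.falsified _ _ h₂ (h.falsified _ _ h₁)
  | @conj G i A B hAB _ _ ih₁ ih₂ =>
    intro h
    have hi := isNode_of_mem_at' hAB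
    by_cases hA : K.Sat (f i) A
    · exact ih₂ f (h.add_singleton hi fun hB => h.falsified _ _ hAB ⟨hA, hB⟩)
    · exact ih₁ f (h.add_singleton hi hA)
  | disj hAB _ ih =>
    intro h
    refine ih f (h.add_ofForms (isNode_of_mem_at' hAB) fun l hl => ?_)
    simp only [Multiset.insert_eq_cons, Multiset.mem_cons, Multiset.mem_singleton] at hl
    rcases hl with rfl | rfl
    · exact fun hA => h.falsified _ _ hAB (.inl hA)
    · exact fun hB => h.falsified _ _ hAB (.inr hB)
  | box hA _ ih =>
    intro h
    have hA' := h.falsified _ _ hA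
    simp only [Falsified, Model.Sat, not_forall] at hA'
    -- The world witnessing that the boxed formula fails interprets the new child.
    obtain ⟨y, hy, hyA⟩ := hA'
    obtain ⟨g, hg⟩ := h.exists_add_boxed (isNode_of_mem_at' hA) hy hyA
    exact ih g hg
  | diaUp he hA _ ih =>
    intro h
    exact ih f (h.add_singleton he.isNode_right fun hS =>
      h.falsified _ _ hA ⟨_, h.edge _ _ _ he, hS⟩)
  | diaDown he hA _ ih =>
    intro h
    exact ih f (h.add_singleton he.isNode_left fun hS =>
      h.falsified _ _ hA ⟨_, (hF.2 _ _ _).1 (h.edge _ _ _ he), hS⟩)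
  | ruleI hA _ ih =>
    intro h
    refine ih f (h.add_singleton (isNode_of_mem_at' hA) fun t y ht hR hS => ?_)
    -- A string accepted from `ini a` lies in the language of `a`, so the frame conditions contract
    -- its path to a single `a`-step, where the false diamond applies.
    rw [hM.accepts_startAt] at ht
    exact h.falsified _ _ hA ⟨y, hK.R_of_mem_lang ht hR, hS⟩
  | ruleF hs hA _ ih =>
    intro h
    exact ih f (h.add_singleton (isNode_of_mem_at' hA)
      (h.falsified _ _ hA [] _ (nil_mem_accepts_startAt hs) rfl))
  | tUp he ht hA _ ih =>
    intro h
    exact ih f (h.add_singleton he.isNode_right fun t y hw hR =>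
      h.falsified _ _ hA _ y (cons_mem_accepts_startAt ht hw) ⟨_, h.edge _ _ _ he, hR⟩)
  | tDown he ht hA _ ih =>
    intro h
    exact ih f (h.add_singleton he.isNode_left fun t y hw hR =>
      h.falsified _ _ hA _ y (cons_mem_accepts_startAt ht hw)
        ⟨_, (hF.2 _ _ _).1 (h.edge _ _ _ he), hR⟩)

/-- A constant interpretation suffices, since a one-node tree has no edges to respect. -/
theorem refutes_single {M : NFA Sg Q} {K : Model Sg W} {x : W} {A : Form Sg}
    (h : ¬ K.Sat x A) : Refutes M K (fun _ => x) (single A) where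
  falsified i l hl := by
    cases i with
    | nil =>
      simp only [at'_nil, single, ofForms, forms, Multiset.mem_singleton] at hl
      subst hl
      exact h
    | cons k i =>
      rw [mem_at'_cons] at hl
      obtain ⟨c, hc, -⟩ := hl
      simp [single, ofForms, children] at hc
  edge i a j he := by
    obtain ⟨D, k, E, hD, hk, -⟩ := he
    cases i with
    | nil => cases hD; simp [single, ofForms, children] at hk
    | cons n i => simp [single, ofForms, children, subAt] at hD

end Soundness

/-! ### Runs of the procedure -/

section Procedure

variable {Sg : Type u} {Q : Type v} [ConverseAlphabet Sg] {M : NFA Sg Q} {ini : Sg → Q}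

/-- The side conditions of the procedure only restrict when a rule is tried; dropping them leaves an
instance of a rule of the calculus. -/
theorem ProofStep.derivable {n : ℕ} {G : NSeq Sg Q} {Gs : List (NSeq Sg Q)}
    (h : ProofStep M ini n G Gs) (hGs : ∀ D ∈ Gs, Derivable M ini D) : Derivable M ini G := by
  cases h with
  | disj h _ => exact .disj h (hGs _ (by simp))
  | conj h _ _ => exact .conj h (hGs _ (by simp)) (hGs _ (by simp))
  | propI h _ => exact .ruleI h (hGs _ (by simp))
  | propF h hs _ => exact .ruleF hs h (hGs _ (by simp))
  | propUp h he ht _ => exact .tUp he ht h (hGs _ (by simp))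
  | propDown h he ht _ => exact .tDown he ht h (hGs _ (by simp))
  | realise _ h _ => exact .box h (hGs _ (by simp))
  | expand _ _ _ h => exact .box h (hGs _ (by simp))

theorem derivable_of_proveReturns_true {G : NSeq Sg Q} (h : ProveReturns M ini G true) :
    Derivable M ini G := by
  generalize hr : true = r at h
  induction h with
  | ident h => obtain ⟨i, p, h₁, h₂⟩ := h; exact .ident h₁ h₂
  | stable => cases hr
  | callsTop h _ ih =>
    obtain ⟨-, -, n, hn, -⟩ := h
    exact hn.derivable fun D hD => ih D hD rfl
  | callsBot => cases hr

theorem exists_stable_of_proveReturns_false {G : NSeq Sg Q} (h : ProveReturns M ini G false) :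
    ∃ D, Relation.ReflTransGen (Calls M ini) G D ∧ D.Stable M ini := by
  generalize hr : false = r at h
  induction h with
  | ident => cases hr
  | stable _ h => exact ⟨_, .refl, h⟩
  | callsTop => cases hr
  | callsBot h hD _ ih =>
    obtain ⟨D', h', hs⟩ := ih hr
    exact ⟨D', .head ⟨_, h, hD⟩ h', hs⟩

theorem ProofStep.mem_forms {n : ℕ} {G D : NSeq Sg Q} {Gs : List (NSeq Sg Q)}
    (h : ProofStep M ini n G Gs) (hD : D ∈ Gs) {l : LForm Sg Q} (hl : l ∈ G.forms) :
    l ∈ D.forms := by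
  cases h <;> simp only [List.mem_cons, List.not_mem_nil, or_false] at hD <;>
    rcases hD with rfl | rfl <;> exact mem_forms_add hl _ _

theorem mem_forms_of_reflTransGen_calls {G D : NSeq Sg Q}
    (h : Relation.ReflTransGen (Calls M ini) G D) {l : LForm Sg Q} (hl : l ∈ G.forms) :
    l ∈ D.forms := by
  induction h with
  | refl => exact hl
  | tail _ h ih =>
    obtain ⟨Gs, ⟨-, -, n, hn, -⟩, hD⟩ := h
    exact hn.mem_forms hD ih

end Procedure

/-! ### The countermodel of a stable sequent -/

namespace NSeq

section Countermodel

variable {Sg : Type u} {Q : Type v} {G : NSeq Sg Q}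

theorem Identified.at'_eq {i k : Pos} (h : G.Identified i k) : G.at' i = G.at' k := by
  obtain ⟨-, ⟨-, rfl⟩ | ⟨-, h⟩⟩ := h
  · rfl
  · exact h.1.2

theorem IsNode.of_isPrefix {i j : Pos} (hi : G.IsNode i) (h : j <+: i) : G.IsNode j := by
  obtain ⟨k, rfl⟩ := h
  unfold IsNode at hi ⊢
  rw [subAt_append] at hi
  cases hj : G.subAt j with
  | none => simp [hj] at hi
  | some D => rfl

/-- The next index on the way from `j` to `i` names a child of `j`. -/
theorem isInternal_of_ancestor {i j : Pos} (hi : G.IsNode i) (h : Ancestor j i) :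
    G.IsInternal j := by
  obtain ⟨⟨l, rfl⟩, hne⟩ := h
  refine ⟨hi.of_isPrefix ⟨l, rfl⟩, fun hleaf => ?_⟩
  cases l with
  | nil => simp at hne
  | cons k l =>
    unfold IsNode at hi
    rw [subAt_append] at hi
    cases hj : G.subAt j with
    | none => simp [hj] at hi
    | some D =>
      rw [hj] at hi
      simp only [Option.bind_some, subAt] at hi
      cases hk : D.children[k]? with
      | none => simp [hk] at hi
      | some c => exact hleaf.2 c.1 (j ++ [k]) ⟨D, k, c.2, hj, hk, rfl⟩

/-- Ancestors of `i` are prefixes of one list, hence a chain ordered by length; the longest one with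
the same formulae is the closest. -/
theorem exists_closestTwin {i j : Pos} (hj : Ancestor j i) (h : G.at' i = G.at' j) :
    ∃ k, G.ClosestTwin i k := by
  classical
  have hP : ∃ n, ∃ j, Ancestor j i ∧ G.at' i = G.at' j ∧ j.length = n := ⟨_, j, hj, h, rfl⟩
  obtain ⟨k, hk, hik, hlen⟩ :=
    Nat.findGreatest_spec (P := fun n => ∃ j, Ancestor j i ∧ G.at' i = G.at' j ∧ j.length = n)
      hj.1.length_le ⟨j, hj, h, rfl⟩
  refine ⟨k, ⟨hk, hik⟩, fun j' hj' h' => List.prefix_of_prefix_length_le hj'.1 hk.1 ?_⟩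
  rw [hlen]
  exact Nat.le_findGreatest hj'.1.length_le ⟨j', hj', h', rfl⟩

variable [ConverseAlphabet Sg] {M : NFA Sg Q} {ini : Sg → Q}

/-- In a stable sequent an unrealised node must be a leaf, and then a loop node. Its twin is a
proper ancestor, hence internal, hence realised: every node is represented by a world. -/
theorem Stable.exists_identified (hG : G.Stable M ini) {i : Pos} (hi : G.IsNode i) :
    ∃ k, G.Identified i k ∧ G.IsNode k ∧ G.Realised k := by
  by_cases hr : G.Realised i
  · exact ⟨i, ⟨hi, .inl ⟨hr, rfl⟩⟩, hi, hr⟩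
  · have hleaf : G.IsLeaf i := by
      by_contra h
      exact hr (hG.2.2.1 i ⟨hi, h⟩)
    obtain ⟨-, j, hj, h⟩ := (hG.2.2.2 i hleaf).resolve_right hr
    obtain ⟨k, hk⟩ := exists_closestTwin hj h
    have hint := isInternal_of_ancestor hi hk.1.1
    exact ⟨k, ⟨hi, .inr ⟨hr, hk⟩⟩, hint.1, hG.2.2.1 k hint⟩

/-- The root has no proper ancestor, so it cannot be a loop node. -/
theorem Stable.realised_root (hG : G.Stable M ini) : G.Realised [] := by
  by_cases hleaf : G.IsLeaf []
  · refine (hG.2.2.2 _ hleaf).resolve_left ?_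
    rintro ⟨-, j, hj, -⟩
    exact hj.2 (List.prefix_nil.1 hj.1)
  · exact hG.2.2.1 _ ⟨rfl, hleaf⟩

/-- The transitions of the automaton `loopAut`. -/
def LoopStep (G : NSeq Sg Q) (i : Pos) (a : Sg) (j : Pos) : Prop :=
  ∃ i₀ j₀, G.Identified i₀ i ∧ G.Identified j₀ j ∧ (G.Edge i₀ a j₀ ∨ G.Edge j₀ (conv a) i₀)

theorem mem_accepts_loopAut {x y : Pos} {s : List Sg} :
    s ∈ (G.loopAut x y).accepts ↔ Run G.LoopStep x s y := by
  rw [NFA.mem_accepts]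
  change (∃ t ∈ ({y} : Set Pos), t ∈ (G.loopAut x y).evalFrom {x} s) ↔ _
  simp only [NFA_mem_evalFrom_iff_run, Set.mem_singleton_iff, exists_eq_left]
  rfl

theorem LoopStep.converse {i j : Pos} {a : Sg} (h : G.LoopStep i a j) :
    G.LoopStep j (conv a) i := by
  obtain ⟨i₀, j₀, hi, hj, h⟩ := h
  exact ⟨j₀, i₀, hj, hi, by rw [conv_conv]; exact h.symm⟩

theorem loopModel_R_iff {S : SemiThue Sg} (hM : Represents M ini S) {a : Sg}
    {x y : {i : Pos // G.IsNode i ∧ G.Realised i}} :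
    (G.loopModel M ini).R a x y ↔ ∃ s ∈ S.lang a, Run G.LoopStep x.1 s y.1 := by
  simp only [loopModel, mem_accepts_loopAut, hM.accepts_startAt]
  exact exists_congr fun s => and_comm

theorem Stable.isFrame_loopModel (hG : G.Stable M ini) {S : SemiThue Sg} (hS : S.IsClosed)
    (hM : Represents M ini S) : (G.loopModel M ini).IsFrame := by
  have key : ∀ a x y, (G.loopModel M ini).R a x y → (G.loopModel M ini).R (conv a) y x := by
    intro a x y h
    rw [loopModel_R_iff hM] at h ⊢
    obtain ⟨s, hs, h⟩ := h
    exact ⟨_, SemiThue.convStr_mem_lang hS hs, h.converse fun _ _ _ => LoopStep.converse⟩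
  refine ⟨⟨⟨[], rfl, hG.realised_root⟩⟩, fun a x y => ⟨key a x y, fun h => ?_⟩⟩
  simpa using key _ _ _ h

/-- Each step of the model along a letter expands to a path spelling a string rewritten from that
letter; concatenating these strings gives one rewritten from `t`. -/
theorem exists_run_of_RStr_loopModel {S : SemiThue Sg} (hM : Represents M ini S) {t : List Sg}
    {x y : {i : Pos // G.IsNode i ∧ G.Realised i}} (h : (G.loopModel M ini).RStr t x y) :
    ∃ s, Relation.ReflTransGen S.RewritesTo t s ∧ Run G.LoopStep x.1 s y.1 := by
  induction t generalizing x with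
  | nil => cases h; exact ⟨[], .refl, rfl⟩
  | cons a t ih =>
    obtain ⟨z, hz, h⟩ := h
    obtain ⟨s, hs, hrun⟩ := (loopModel_R_iff hM).1 hz
    obtain ⟨s', hs', hrun'⟩ := ih h
    exact ⟨s ++ s', SemiThue.reflTransGen_append (x := [a]) hs hs', hrun.append hrun'⟩

theorem satisfiesSystem_loopModel {S : SemiThue Sg} (hS : S.IsContextFree)
    (hM : Represents M ini S) : (G.loopModel M ini).SatisfiesSystem S := by
  intro s t hst x y h
  obtain ⟨a, rfl⟩ := hS _ _ hst
  rw [Model.RStr_singleton, loopModel_R_iff hM]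
  obtain ⟨w, hw, hrun⟩ := exists_run_of_RStr_loopModel hM h
  -- The production is applied first, and its right side is then rewritten to `w`.
  exact ⟨w, .head ⟨[], [], [a], t, hst, by simp, by simp⟩ hw, hrun⟩

/-- The tree and the automaton read the same string. A transition is witnessed by an edge between
nodes `x₀`, `z₀` identified with its endpoints, and labelled formulae transfer between identified
nodes because their multisets agree. -/
theorem Propagated.lab_mem_of_run (hG : G.Propagated M ini) {x y : Pos} {s : List Sg}
    (h : Run G.LoopStep x s y) {q r : Q} (hM : Run (fun i a j => j ∈ M.step i a) q s r)
    {A : Form Sg} (hA : lab q A ∈ G.at' x) : lab r A ∈ G.at' y := by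
  induction s generalizing x q with
  | nil => cases h; cases hM; exact hA
  | cons a s ih =>
    obtain ⟨z, ⟨x₀, z₀, hx, hz, he⟩, h⟩ := h
    obtain ⟨t, ht, hM⟩ := hM
    refine ih h hM ?_
    rw [← hx.at'_eq] at hA
    rw [← hz.at'_eq]
    rcases he with he | he
    · exact (hG x₀ he.isNode_left).2.2.1 z₀ a q t he ht A hA
    -- The edge from `z₀` to `x₀` is labelled `conv a`, so moving up it reads `conv (conv a)`, which
    -- is `a`.
    · exact (hG x₀ he.isNode_right).2.2.2 z₀ (conv a) q t he (by rwa [conv_conv]) A hA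

theorem Stable.not_sat_loopModel (hG : G.Stable M ini) {S : SemiThue Sg}
    (hM : Represents M ini S) (A : Form Sg) (x : {i : Pos // G.IsNode i ∧ G.Realised i})
    (hA : plain A ∈ G.at' x.1) : ¬ (G.loopModel M ini).Sat x A := by
  -- These facts depend on `x`, so generalising `x` makes them arguments of the induction
  -- hypotheses, to be supplied anew at each new world.
  obtain ⟨hid, hdisj, hconj⟩ := hG.1 x.1 x.2.1
  induction A generalizing x with
  | atom p => exact hid _ hA
  | natom p => exact fun h => h hA
  | disj A B ihA ihB =>
    obtain ⟨h₁, h₂⟩ := hdisj A B hA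
    exact fun h => h.elim (ihA x h₁ hid hdisj hconj) (ihB x h₂ hid hdisj hconj)
  | conj A B ihA ihB =>
    rcases hconj A B hA with h | h
    · exact fun hS => ihA x h hid hdisj hconj hS.1
    · exact fun hS => ihB x h hid hdisj hconj hS.2
  | box a A ih =>
    intro hS
    obtain ⟨j, he, hj⟩ := x.2.2 a A hA
    -- The child `j` need not be a world; its representative `k` is one and carries the same
    -- formulae. The one-letter string `[a]`, which belongs to the language of `a`, makes `k`
    -- accessible.
    obtain ⟨k, hk, hkn, hkr⟩ := hG.exists_identified he.isNode_right
    obtain ⟨h₁, h₂, h₃⟩ := hG.1 k hkn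
    refine ih ⟨k, hkn, hkr⟩ (hk.at'_eq ▸ hj) h₁ h₂ h₃ (hS _ ?_)
    rw [loopModel_R_iff hM]
    exact ⟨[a], .refl, k, ⟨x.1, j, ⟨x.2.1, .inl ⟨x.2.2, rfl⟩⟩, hk, .inl he⟩, rfl⟩
  | dia a A ih =>
    rintro ⟨y, ⟨s, hs, hsM⟩, hS⟩
    rw [mem_accepts_loopAut] at hs
    obtain ⟨q, hq, hrun⟩ := (mem_accepts_startAt M _ _).1 hsM
    -- The diamond places `A` at `x` with label `ini a`. Following the common string brings `A` to
    -- `y` with the accepting label `q`, where propagation removes the label.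
    have hy := hG.2.1.lab_mem_of_run hs hrun ((hG.2.1 x.1 x.2.1).1 a A hA)
    obtain ⟨h₁, h₂, h₃⟩ := hG.1 y.1 y.2.1
    exact ih y ((hG.2.1 y.1 y.2.1).2.1 q A hy hq) h₁ h₂ h₃ hS

end Countermodel

end NSeq

end GrammarLogic

theorem mainTheorem6 {Sg : Type*} [GrammarLogic.ConverseAlphabet Sg] {Q : Type*} [Finite Q]
    (S : GrammarLogic.SemiThue Sg) (hclosed : S.IsClosed) (hreg : S.IsRegular)
    (M : NFA Sg Q) (ini : Sg → Q) (hM : GrammarLogic.Represents M ini S)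
    (F : GrammarLogic.Form Sg) :
    (GrammarLogic.ProveReturns M ini (GrammarLogic.NSeq.single F) true →
      GrammarLogic.Derivable M ini (GrammarLogic.NSeq.single F)) ∧
    (GrammarLogic.ProveReturns M ini (GrammarLogic.NSeq.single F) false →
      ¬ GrammarLogic.Derivable M ini (GrammarLogic.NSeq.single F) ∧
      ∃ D : GrammarLogic.NSeq Sg Q,
        Relation.ReflTransGen (GrammarLogic.Calls M ini) (GrammarLogic.NSeq.single F) D ∧
        D.Stable M ini ∧
        (D.loopModel M ini).IsFrame ∧
        (D.loopModel M ini).SatisfiesSystem S ∧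
        ∃ root : {i : GrammarLogic.Pos // D.IsNode i ∧ D.Realised i},
          root.1 = [] ∧ ¬ (D.loopModel M ini).Sat root F) := by
  refine ⟨GrammarLogic.derivable_of_proveReturns_true, fun h => ?_⟩
  obtain ⟨D, hcalls, hD⟩ := GrammarLogic.exists_stable_of_proveReturns_false h
  have hF : GrammarLogic.LForm.plain F ∈ D.at' [] :=
    GrammarLogic.mem_forms_of_reflTransGen_calls hcalls (Multiset.mem_singleton_self _)
  have hframe := hD.isFrame_loopModel hclosed hM
  have hsys : (D.loopModel M ini).SatisfiesSystem S :=
    GrammarLogic.NSeq.satisfiesSystem_loopModel hreg.1 hM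
  have hroot := hD.not_sat_loopModel hM F ⟨[], rfl, hD.realised_root⟩ hF
  -- Soundness is applied to the countermodel itself, with every position sent to the root world.
  exact ⟨fun hder => hder.not_refutes hM hframe hsys _ (GrammarLogic.refutes_single hroot),
    D, hcalls, hD, hframe, hsys, ⟨[], rfl, hD.realised_root⟩, rfl, hroot⟩
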